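/- All spaces, sets and algebras are small; Boolean algebras with $0=1$ and the empty space are allowed. Let $\mathbf{ZHLC}$ be the category of locally compact Hausdorff zero-dimensional spaces (zero-dimensional: the clopen sets form a base) and continuous maps. For a Boolean algebra $A$ let $S(A)$ be the set of Boolean homomorphisms $x:A\to\mathbf 2$ with the topology generated by the sets $s_A(a)=\{x : x(a)=1\}$, $a\in A$. Let $\alpha:A\to B$ be a Boolean homomorphism into a complete atomic Boolean algebra $B$. For an atom $x$ of $B$ let $\alpha_x\in S(A)$ be given by $\alpha_x(a)=1\Leftrightarrow x\le\alpha(a)$, and let $X_\alpha=\{\alpha_x : x\in\mathrm{At}(B)\}$ with the subspace topology from $S(A)$. Call $\alpha$ an lmz-map if 1. $\alpha$ is injective and every atom of $B$ is a meet of elements of $\alpha(A)$; 2. the clopen subsets of $X_\alpha$ are exactly the sets $X_\alpha\cap s_A(a)$, $a\in A$; 3. for every atom $x$ of $B$ there is $a\in A$ with $\alpha_x\in s_A(a)\subseteq X_\alpha$. Let $\mathbf{LMBool}$ be the category whose objects are the lmz-maps and whose morphisms from $\alpha:A\to B$ to $\alpha':A'\to B'$ are the pairs $(\varphi,\sigma)$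 of a Boolean homomorphism $\varphi:A\to A'$ and a complete Boolean homomorphism $\sigma:B\to B'$ with $\alpha'\circ\varphi=\sigma\circ\alpha$, with componentwise composition. **Theorem.** The categories $\mathbf{ZHLC}$ and $\mathbf{LMBool}$ are dually equivalent. More precisely, there are well-defined contravariant functors * $F:\mathbf{ZHLC}\to\mathbf{LMBool}$, sending a space $X$ to the inclusion $CO(X)\to P(X)$ of the Boolean algebra of clopen subsets of $X$ into the power set of $X$, and a continuous map $f:X\to Y$ to the pair $(U\mapsto f^{-1}(U),\ M\mapsto f^{-1}(M))$, where $U\in CO(Y)$ and $M\in P(Y)$; * $G:\mathbf{LMBool}\to\mathbf{ZHLC}$, sending an lmz-map $\alpha$ to the space $X_\alpha$, and a morphism $(\varphi,\sigma):\alpha\to\alpha'$ to the continuous map $X_{\alpha'}\to X_\alpha$, $\alpha'_{x}\mapsto\alpha_{\mathrm{At}(\sigma)(x)}$, where $\mathrm{At}(\sigma)(x)=\bigwedge\{b\in B : x\le\sigma(b)\}$ for $x\in\mathrm{At}(B')$; and $F$ and $G$ are mutually quasi-inverse, i.e. both composites are naturally isomorphic to the identity functors. -/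

import Mathlib

open CategoryTheory Opposite TopologicalSpace

universe u v w

namespace BooleanDuality

/-! ### Boolean spaces -/

/-- A topological space is zero-dimensional if its clopen subsets form a base. -/
def IsZeroDimensional (X : Type u) [TopologicalSpace X] : Prop :=
  IsTopologicalBasis {U : Set X | IsClopen U}

/-- The class of Boolean spaces, i.e. of locally compact Hausdorff zero-dimensional spaces. -/
def IsBooleanSpace : ObjectProperty TopCat.{u} := fun X =>
  LocallyCompactSpace X ∧ T2Space X ∧ IsZeroDimensional X

/-- The category of Boolean spaces and all continuous maps between them. -/
abbrev ZHLC : Type (u + 1) := (IsBooleanSpace.{u}).FullSubcategory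

/-! ### The Stone space of a Boolean algebra -/

section Stone

variable (A : Type u) [BooleanAlgebra A]

/-- The underlying set of the Stone space of `A`: the Boolean homomorphisms from `A` to the
two-element Boolean algebra. -/
abbrev StoneSpace : Type u := BoundedLatticeHom A Bool

variable {A}

/-- The basic set of all `x` in the Stone space with `x a = 1`. -/
def stoneSet (a : A) : Set (StoneSpace A) := {x | x a = true}

/-- The Stone topology, generated by the sets `stoneSet a`. -/
instance stoneTopology : TopologicalSpace (StoneSpace A) :=
  generateFrom (Set.range (stoneSet (A := A)))

end Stone

theorem atom_le_sup_iff {B : Type u} [BooleanAlgebra B] {x : B} (hx : IsAtom x) (b c : B) :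
    x ≤ b ⊔ c ↔ x ≤ b ∨ x ≤ c := by
  refine ⟨fun h => ?_, fun h => h.elim le_sup_of_le_left le_sup_of_le_right⟩
  by_cases hb : x ≤ b
  · exact Or.inl hb
  · exact Or.inr (Disjoint.left_le_of_le_sup_left h (hx.not_le_iff_disjoint.1 hb))

/-! ### z-maps, mz-maps and lmz-maps

Below `A` is a Boolean algebra and `B` a complete atomic Boolean algebra. -/

section Maps

variable {A : Type u} [BooleanAlgebra A] {B : Type v} [CompleteBooleanAlgebra B]

/-- For an atom `x` of `B`, the Boolean homomorphism `α_x` from `A` to the two-element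
algebra, with `α_x a = 1` iff `x ≤ α a`. -/
noncomputable def atomHom (α : BoundedLatticeHom A B) (x : {x : B // IsAtom x}) :
    StoneSpace A := by
  classical
  exact
  { toFun := fun a => decide (x.1 ≤ α a)
    map_sup' := fun a b => by
      have h : x.1 ≤ α a ⊔ α b ↔ x.1 ≤ α a ∨ x.1 ≤ α b :=
        atom_le_sup_iff x.2 _ _
      simp [map_sup, h]
    map_inf' := fun a b => by simp [map_inf]
    map_top' := by simp
    map_bot' := by simpa using x.2.1 }

theorem atomHom_eq_true_iff (α : BoundedLatticeHom A B) (x : {x : B // IsAtom x}) (a : A) :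
    atomHom α x a = true ↔ x.1 ≤ α a := by
  classical
  exact decide_eq_true_iff

/-- The set `X_α = {α_x | x an atom of B}` of points of the Stone space of `A`. -/
def pointSet (α : BoundedLatticeHom A B) : Set (StoneSpace A) := Set.range (atomHom α)

/-- A z-map: an injective Boolean homomorphism `α` such that each atom of the codomain is a meet
of elements of the image of `α`. -/
structure IsZMap (α : BoundedLatticeHom A B) : Prop where
  injective : Function.Injective α
  atom_eq_sInf : ∀ x : B, IsAtom x → ∃ S : Set A, x = sInf (α '' S)

/-- A z-map `α` is an mz-map if the clopen subsets of the subspace `X_α` are exactly the traces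
on `X_α` of the sets `stoneSet a`. -/
structure IsMZMap (α : BoundedLatticeHom A B) : Prop extends IsZMap α where
  clopen_eq : {U : Set (pointSet α) | IsClopen U} =
    Set.range fun a : A => {y : pointSet α | y.1 ∈ stoneSet a}

/-- An mz-map `α` is an lmz-map if for each atom `x` some basic set `stoneSet a` contains `α_x`
and is contained in `X_α`. -/
structure IsLMZMap (α : BoundedLatticeHom A B) : Prop extends IsMZMap α where
  exists_stoneSet : ∀ x : {x : B // IsAtom x}, ∃ a : A,
    atomHom α x ∈ stoneSet a ∧ stoneSet a ⊆ pointSet α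

end Maps

/-! ### The category of lmz-maps -/

/-- A Boolean homomorphism from a Boolean algebra to a complete atomic Boolean algebra. -/
structure BoolMap : Type (u + 1) where
  dom : Type u
  cod : Type u
  [boolDom : BooleanAlgebra dom]
  [boolCod : CompleteBooleanAlgebra cod]
  [atomicCod : IsAtomic cod]
  map : BoundedLatticeHom dom cod

attribute [instance] BoolMap.boolDom BoolMap.boolCod BoolMap.atomicCod

namespace BoolMap

/-- A morphism from `α : A → B` to `α' : A' → B'` is a pair of a Boolean homomorphism
`φ : A → A'` and a complete Boolean homomorphism `σ : B → B'` with `α' ∘ φ = σ ∘ α`. -/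
@[ext]
structure Hom (α β : BoolMap.{u}) : Type u where
  φ : BoundedLatticeHom α.dom β.dom
  σ : CompleteLatticeHom α.cod β.cod
  comm : ∀ a : α.dom, β.map (φ a) = σ (α.map a)

/-- The category of such homomorphisms, with componentwise identities and composition. -/
instance : Category BoolMap.{u} where
  Hom := Hom
  id α := ⟨BoundedLatticeHom.id _, CompleteLatticeHom.id _, fun _ => rfl⟩
  comp f g := ⟨g.φ.comp f.φ, g.σ.comp f.σ, fun a => by
    change _ = g.σ (f.σ _)
    rw [← f.comm, ← g.comm]
    rfl⟩

end BoolMap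

/-- The lmz-maps among the objects of `BoolMap`. -/
def IsLMZ : ObjectProperty BoolMap.{u} := fun α => IsLMZMap α.map

/-- The category of all lmz-maps, as a full subcategory. -/
abbrev LMBool : Type (u + 1) := (IsLMZ.{u}).FullSubcategory

/-! ### From spaces to Boolean homomorphisms -/

/-- The inclusion map of the Boolean algebra `CO(X)` of clopen subsets of `X` into the power
set `P(X)`. -/
def clopensIncl (X : Type u) [TopologicalSpace X] : BoundedLatticeHom (Clopens X) (Set X) where
  toFun U := (U : Set X)
  map_sup' _ _ := rfl
  map_inf' _ _ := rfl
  map_top' := rfl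
  map_bot' := rfl

/-- The Boolean homomorphism `U ↦ f⁻¹(U)` from `CO(Y)` to `CO(X)`, for `f : X → Y` continuous. -/
def clopensComap {X : Type u} {Y : Type v} [TopologicalSpace X] [TopologicalSpace Y]
    (f : C(X, Y)) : BoundedLatticeHom (Clopens Y) (Clopens X) where
  toFun U := ⟨f ⁻¹' U, U.isClopen.preimage f.continuous⟩
  map_sup' _ _ := rfl
  map_inf' _ _ := rfl
  map_top' := rfl
  map_bot' := rfl

/-- The contravariant functor taking a space `X` to the inclusion of `CO(X)` into `P(X)` and a
continuous map `f` to the pair `(U ↦ f⁻¹(U), M ↦ f⁻¹(M))`. -/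
def clopenFunctor : TopCat.{u}ᵒᵖ ⥤ BoolMap.{u} where
  obj X := { dom := Clopens X.unop, cod := Set X.unop, map := clopensIncl X.unop }
  map f := ⟨clopensComap f.unop.hom, CompleteLatticeHom.setPreimage f.unop.hom, fun _ => rfl⟩
  map_id _ := rfl
  map_comp _ _ := rfl

/-! ### From Boolean homomorphisms to spaces -/

section AtomMap

variable {B : Type u} [CompleteBooleanAlgebra B] {B' : Type v} [CompleteBooleanAlgebra B']
  (σ : CompleteLatticeHom B B')

theorem atomMap_le_iff (x : B') (b : B) : sInf {b : B | x ≤ σ b} ≤ b ↔ x ≤ σ b := by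
  refine ⟨fun h => ?_, fun h => sInf_le h⟩
  refine le_trans ?_ (OrderHomClass.mono σ h)
  rw [map_sInf]
  exact le_sInf (by rintro _ ⟨c, hc, rfl⟩; exact hc)

/-- The map `At(σ) : At(B') → At(B)`, `x ↦ ⋀ {b | x ≤ σ b}`, induced by a complete
homomorphism `σ : B → B'`. -/
def atomMap (x : {x : B' // IsAtom x}) : {b : B // IsAtom b} :=
  ⟨sInf {b : B | x.1 ≤ σ b}, by
    refine ⟨fun h => ?_, fun b hb => ?_⟩
    · have := (atomMap_le_iff σ x.1 ⊥).1 h.le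
      rw [map_bot] at this
      exact x.2.1 (le_bot_iff.1 this)
    · have hn : ¬ x.1 ≤ σ b := fun h =>
        absurd ((atomMap_le_iff σ x.1 b).2 h) (not_le_of_gt hb)
      have hc : x.1 ≤ σ b ⊔ σ bᶜ := by
        rw [← map_sup, sup_compl_eq_top, map_top]
        exact le_top
      rcases (atom_le_sup_iff x.2 _ _).1 hc with h | h
      · exact absurd h hn
      · have h' := (atomMap_le_iff σ x.1 bᶜ).2 h
        exact le_compl_self.1 (hb.le.trans h')⟩

end AtomMap

/-- For `(φ, σ) : α → α'` and an atom `x` of the codomain of `α'`, one has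
`α'_x ∘ φ = α_{At(σ)(x)}`. -/
theorem atomHom_comp {α β : BoolMap.{u}} (f : α ⟶ β) (x : {x : β.cod // IsAtom x}) :
    (atomHom β.map x).comp f.φ = atomHom α.map (atomMap f.σ x) := by
  ext a
  rw [Bool.eq_iff_iff]
  change atomHom β.map x (f.φ a) = true ↔ _
  rw [atomHom_eq_true_iff, atomHom_eq_true_iff, f.comm]
  exact (atomMap_le_iff f.σ x.1 _).symm

/-- The map `X_α' → X_α`, `α'_x ↦ α_{At(σ)(x)}`, induced by `(φ, σ) : α → α'`. It is given by
`y ↦ y ∘ φ`; see `pointMap_apply` for the formula on the points `α'_x`. -/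
noncomputable def pointMap {α β : BoolMap.{u}} (f : α ⟶ β) : C(pointSet β.map, pointSet α.map) where
  toFun y := ⟨y.1.comp f.φ, by
    obtain ⟨_, x, rfl⟩ := y
    exact ⟨atomMap f.σ x, (atomHom_comp f x).symm⟩⟩
  continuous_toFun := by
    refine Continuous.subtype_mk ?_ _
    have h : Continuous fun y : StoneSpace β.dom => (y.comp f.φ : StoneSpace α.dom) := by
      refine continuous_generateFrom_iff.2 ?_
      rintro _ ⟨a, rfl⟩
      exact isOpen_generateFrom_of_mem ⟨f.φ a, rfl⟩
    exact h.comp continuous_subtype_val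

/-- The point `α_x` of `X_α`. -/
noncomputable def point (α : BoolMap.{u}) (x : {x : α.cod // IsAtom x}) : pointSet α.map :=
  ⟨atomHom α.map x, x, rfl⟩

theorem pointMap_apply {α β : BoolMap.{u}} (f : α ⟶ β) (x : {x : β.cod // IsAtom x}) :
    pointMap f (point β x) = point α (atomMap f.σ x) :=
  Subtype.ext (atomHom_comp f x)

/-- The contravariant functor taking `α : A → B` to the subspace `X_α` of the Stone space of `A`
and a morphism `(φ, σ) : α → α'` to the map `X_α' → X_α`, `α'_x ↦ α_{At(σ)(x)}`. -/
noncomputable def pointFunctor : BoolMap.{u}ᵒᵖ ⥤ TopCat.{u} where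
  obj α := TopCat.of (pointSet α.unop.map)
  map f := TopCat.ofHom (pointMap f.unop)
  map_id _ := rfl
  map_comp _ _ := rfl

end BooleanDuality

open BooleanDuality

namespace BooleanDuality

/-! ### Topology of the Stone space -/

section Stone

variable {A : Type u} [BooleanAlgebra A]

/-! This is Stone duality with the points recorded as atoms of the second algebra. The Stone space
is compact Hausdorff and totally disconnected, and condition 3 makes `X_α` open in it, so `X_α` is a
Boolean space. For a Boolean space `X`, the map `spacePoint` is a homeomorphism onto the space of
`CO(X) → P(X)`. That this inclusion satisfies condition 3 rests on `stoneSet_subset_pointSet`: an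
ultrafilter of clopen sets with a compact member is fixed by a point. Conversely, atomicity of `B`
with condition 1 identifies `B` with `P(X_α)` through `pointsBelow`, and injectivity of `α` with
condition 2 identifies `A` with `CO(X_α)` through `clopenTrace`. Both identifications are natural.
-/

theorem compl_stoneSet (a : A) : (stoneSet a)ᶜ = stoneSet aᶜ := by
  ext x
  simp [stoneSet]

theorem isOpen_stoneSet (a : A) : IsOpen (stoneSet a) :=
  isOpen_generateFrom_of_mem ⟨a, rfl⟩

theorem isClopen_stoneSet (a : A) : IsClopen (stoneSet a) :=
  ⟨⟨compl_stoneSet a ▸ isOpen_stoneSet aᶜ⟩, isOpen_stoneSet a⟩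

theorem continuous_stone_eval (a : A) : Continuous fun x : StoneSpace A => x a := by
  refine continuous_bool_rng true |>.2 ?_
  exact isClopen_stoneSet a

theorem isInducing_stone_coe :
    Topology.IsInducing (fun (x : StoneSpace A) (a : A) => x a) := by
  refine ⟨le_antisymm (continuous_iff_le_induced.1 (continuous_pi continuous_stone_eval)) ?_⟩
  refine le_generateFrom ?_
  rintro _ ⟨a, rfl⟩
  exact ⟨(fun g => g a) ⁻¹' {true}, (isOpen_discrete _).preimage (continuous_apply a), rfl⟩

/-- Preservation of each operation at given arguments is an equation between continuous functions on
the cube `A → Bool`, hence a closed condition. -/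
theorem isClosed_range_stone_coe :
    IsClosed (Set.range fun (x : StoneSpace A) (a : A) => x a) := by
  have h : (Set.range fun (x : StoneSpace A) (a : A) => x a) =
      (({g : A → Bool | g ⊤ = ⊤} ∩ {g | g ⊥ = ⊥}) ∩
        ⋂ (a : A) (b : A), {g | g (a ⊔ b) = g a ⊔ g b}) ∩
        ⋂ (a : A) (b : A), {g | g (a ⊓ b) = g a ⊓ g b} := by
    ext g
    simp only [Set.mem_range, Set.mem_inter_iff, Set.mem_iInter, Set.mem_ofPred_eq]
    constructor
    · rintro ⟨x, rfl⟩
      exact ⟨⟨⟨map_top x, map_bot x⟩, map_sup x⟩, map_inf x⟩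
    · rintro ⟨⟨⟨ht, hb⟩, hs⟩, hi⟩
      exact ⟨⟨⟨⟨g, hs⟩, hi⟩, ht, hb⟩, rfl⟩
  rw [h]
  refine (((isClosed_eq (continuous_apply _) continuous_const).inter
    (isClosed_eq (continuous_apply _) continuous_const)).inter ?_).inter ?_
  · exact isClosed_iInter fun a => isClosed_iInter fun b => isClosed_eq (continuous_apply _)
      ((continuous_of_discreteTopology (f := fun p : Bool × Bool => p.1 ⊔ p.2)).comp
        (g := fun p : Bool × Bool => p.1 ⊔ p.2) (f := fun g : A → Bool => (g a, g b))
        ((continuous_apply a).prodMk (continuous_apply b)))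
  · exact isClosed_iInter fun a => isClosed_iInter fun b => isClosed_eq (continuous_apply _)
      ((continuous_of_discreteTopology (f := fun p : Bool × Bool => p.1 ⊓ p.2)).comp
        (g := fun p : Bool × Bool => p.1 ⊓ p.2) (f := fun g : A → Bool => (g a, g b))
        ((continuous_apply a).prodMk (continuous_apply b)))

theorem isClosedEmbedding_stone_coe :
    Topology.IsClosedEmbedding (fun (x : StoneSpace A) (a : A) => x a) :=
  ⟨⟨isInducing_stone_coe, DFunLike.coe_injective⟩, isClosed_range_stone_coe⟩

instance : CompactSpace (StoneSpace A) := isClosedEmbedding_stone_coe.compactSpace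

instance : T2Space (StoneSpace A) := isClosedEmbedding_stone_coe.isEmbedding.t2Space

instance : TotallyDisconnectedSpace (StoneSpace A) :=
  ⟨isClosedEmbedding_stone_coe.isEmbedding.isTotallyDisconnected
    (isTotallyDisconnected_of_totallyDisconnectedSpace _)⟩

end Stone

/-! ### The space of an lmz-map -/

section PointSet

variable {A : Type u} [BooleanAlgebra A] {B : Type v} [CompleteBooleanAlgebra B]
  {α : BoundedLatticeHom A B}

/-- This is the source of local compactness: open subspaces of compact Hausdorff spaces are locally
compact. -/
theorem IsLMZMap.isOpen_pointSet (h : IsLMZMap α) : IsOpen (pointSet α) := by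
  refine isOpen_iff_forall_mem_open.2 ?_
  rintro _ ⟨x, rfl⟩
  obtain ⟨a, hx, ha⟩ := h.exists_stoneSet x
  exact ⟨_, ha, isOpen_stoneSet a, hx⟩

/-- An atom is a meet of elements `α a`, so knowing which `α a` lie above it determines it. -/
theorem IsZMap.atomHom_injective (h : IsZMap α) : Function.Injective (atomHom α) := by
  intro x y hxy
  obtain ⟨S, hS⟩ := h.atom_eq_sInf x.1 x.2
  have hyx : y.1 ≤ x.1 := by
    rw [hS]
    refine le_sInf ?_
    rintro _ ⟨a, ha, rfl⟩
    rw [← atomHom_eq_true_iff, ← hxy, atomHom_eq_true_iff, hS]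
    exact sInf_le ⟨a, ha, rfl⟩
  exact Subtype.ext ((x.2.le_iff_eq y.2.1).1 hyx).symm

end PointSet

theorem IsLMZ.isBooleanSpace {α : BoolMap.{u}} (h : IsLMZ α) :
    IsBooleanSpace (TopCat.of (pointSet α.map)) := by
  have : LocallyCompactSpace (pointSet α.map) := IsLMZMap.isOpen_pointSet h |>.locallyCompactSpace
  exact ⟨this, inferInstanceAs (T2Space (pointSet α.map)),
    loc_compact_Haus_tot_disc_of_zero_dim (H := pointSet α.map)⟩

/-! ### The lmz-map of a Boolean space -/

section Space

variable {X : Type u} [TopologicalSpace X]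

/-- The point of the space of `CO(X) → P(X)` given by a point of `X`. -/
noncomputable def spacePoint (x : X) : pointSet (clopensIncl X) :=
  ⟨atomHom (clopensIncl X) ⟨{x}, Set.isAtom_singleton x⟩, _, rfl⟩

theorem spacePoint_mem_stoneSet_iff (x : X) (U : Clopens X) :
    (spacePoint x).1 ∈ stoneSet U ↔ x ∈ U :=
  (atomHom_eq_true_iff _ _ _).trans Set.singleton_subset_iff

theorem spacePoint_surjective : Function.Surjective (spacePoint (X := X)) := by
  rintro ⟨_, ⟨y, hy⟩, rfl⟩
  obtain ⟨x, rfl⟩ := Set.isAtom_iff.1 hy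
  exact ⟨x, rfl⟩

theorem exists_clopen_of_ne [T2Space X] (hX : IsZeroDimensional X) {x y : X} (h : x ≠ y) :
    ∃ U : Clopens X, x ∈ U ∧ y ∉ U := by
  obtain ⟨U, hU, hx, hUy⟩ := hX.exists_subset_of_mem_open (show x ∈ ({y}ᶜ : Set X) from h)
    isOpen_compl_singleton
  exact ⟨⟨U, hU⟩, hx, fun hy => hUy hy rfl⟩

theorem spacePoint_injective [T2Space X] (hX : IsZeroDimensional X) :
    Function.Injective (spacePoint (X := X)) := by
  intro x y hxy
  by_contra h
  obtain ⟨U, hx, hy⟩ := exists_clopen_of_ne hX h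
  rw [← spacePoint_mem_stoneSet_iff] at hx hy
  exact hy (hxy ▸ hx)

theorem isInducing_spacePoint (hX : IsZeroDimensional X) :
    Topology.IsInducing (spacePoint (X := X)) := by
  refine ⟨le_antisymm ?_ ?_⟩
  · refine continuous_iff_le_induced.1 (Continuous.subtype_mk
      (continuous_generateFrom_iff.2 ?_) _)
    rintro _ ⟨U, rfl⟩
    convert U.isClopen.isOpen
    ext x
    exact spacePoint_mem_stoneSet_iff x U
  · refine (le_generateFrom fun U hU => ?_).trans_eq hX.eq_generateFrom.symm
    refine ⟨Subtype.val ⁻¹' stoneSet (⟨U, hU⟩ : Clopens X),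
      (isOpen_stoneSet _).preimage continuous_subtype_val, ?_⟩
    ext x
    exact spacePoint_mem_stoneSet_iff x ⟨U, hU⟩

/-- A zero-dimensional Hausdorff space is homeomorphic to the space of `CO(X) → P(X)`. -/
noncomputable def spaceHomeomorph [T2Space X] (hX : IsZeroDimensional X) :
    X ≃ₜ pointSet (clopensIncl X) :=
  (Equiv.ofBijective spacePoint
    ⟨spacePoint_injective hX, spacePoint_surjective⟩).toHomeomorphOfIsInducing
    (isInducing_spacePoint hX)

/-- A point of the Stone space of `CO(X)` that contains a compact clopen set is given by a point
of `X`. -/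
theorem stoneSet_subset_pointSet (K : Clopens X) (hK : IsCompact (K : Set X)) :
    stoneSet K ⊆ pointSet (clopensIncl X) := by
  intro y hy
  -- The clopen sets accepted by `y` form an ultrafilter containing `K`; their traces on `K` are
  -- compact, nonempty and directed downwards, so they share a point.
  have hne : (⋂ U : {U : Clopens X // y U = true}, ((K ⊓ U.1 : Clopens X) : Set X)).Nonempty := by
    have : Nonempty {U : Clopens X // y U = true} := ⟨⟨K, hy⟩⟩
    refine IsCompact.nonempty_iInter_of_directed_nonempty_isCompact_isClosed _ ?_ ?_ ?_ ?_
    · rintro ⟨U, hU⟩ ⟨V, hV⟩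
      refine ⟨⟨U ⊓ V, by simp [map_inf, hU, hV]⟩, ?_, ?_⟩
      · exact Set.inter_subset_inter_right _ Set.inter_subset_left
      · exact Set.inter_subset_inter_right _ Set.inter_subset_right
    · rintro ⟨U, hU⟩
      by_contra hn
      have h0 : K ⊓ U = ⊥ := SetLike.coe_injective (Set.not_nonempty_iff_eq_empty.1 hn)
      have h1 : y (K ⊓ U) = true := by
        rw [map_inf, hU]
        simpa [stoneSet] using hy
      rw [h0, map_bot] at h1
      exact Bool.false_ne_true h1
    · exact fun U => hK.inter_right U.1.isClopen.isClosed
    · exact fun U => (K ⊓ U.1).isClopen.isClosed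
  obtain ⟨x, hx⟩ := hne
  have hmem : ∀ U : Clopens X, y U = true → x ∈ U := fun U hU => (Set.mem_iInter.1 hx ⟨U, hU⟩).2
  refine ⟨⟨{x}, Set.isAtom_singleton x⟩, ?_⟩
  ext U
  rw [Bool.eq_iff_iff]
  refine (spacePoint_mem_stoneSet_iff x U).trans ⟨fun hU => ?_, hmem U⟩
  -- Maximality of the ultrafilter: if `y` rejects `U`, it accepts the complement, which then
  -- contains `x`.
  by_contra hn
  have hc : y Uᶜ = true := by simpa [map_compl'] using hn
  exact hmem _ hc hU

/-- Clopen separation of points gives condition 1, the homeomorphism `spaceHomeomorph` gives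
condition 2, and a clopen neighbourhood inside a compact one gives condition 3. -/
theorem isLMZMap_clopensIncl [LocallyCompactSpace X] [T2Space X] (hX : IsZeroDimensional X) :
    IsLMZMap (clopensIncl X) where
  injective := SetLike.coe_injective
  atom_eq_sInf x hx := by
    obtain ⟨x, rfl⟩ := Set.isAtom_iff.1 hx
    refine ⟨{U | x ∈ U}, Set.Subset.antisymm ?_ ?_⟩
    · rintro _ rfl _ ⟨U, hU, rfl⟩
      exact hU
    · intro y hy
      by_contra h
      obtain ⟨U, hx, hyU⟩ := exists_clopen_of_ne hX (Ne.symm h)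
      exact hyU (hy _ ⟨U, hx, rfl⟩)
  clopen_eq := by
    refine Set.Subset.antisymm (fun U hU => ?_) ?_
    · refine ⟨⟨_, hU.preimage (spaceHomeomorph hX).continuous⟩, ?_⟩
      ext y
      obtain ⟨x, rfl⟩ := spacePoint_surjective y
      exact spacePoint_mem_stoneSet_iff x _
    · rintro _ ⟨U, rfl⟩
      exact (isClopen_stoneSet U).preimage continuous_subtype_val
  exists_stoneSet x := by
    obtain ⟨x, hx⟩ := x
    obtain ⟨x, rfl⟩ := Set.isAtom_iff.1 hx
    obtain ⟨K, hK, hxK⟩ := exists_compact_mem_nhds x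
    obtain ⟨U, hU, hxU, hUK⟩ := hX.mem_nhds_iff.1 hxK
    exact ⟨⟨U, hU⟩, (spacePoint_mem_stoneSet_iff x ⟨U, hU⟩).2 hxU,
      stoneSet_subset_pointSet _ (hK.of_isClosed_subset hU.isClosed hUK)⟩

end Space

/-! ### The natural isomorphism of an lmz-map with the map of its space -/

section Counit

/-- An isomorphism of Boolean homomorphisms from a commutative square of order isomorphisms. -/
def BoolMap.isoMk {α β : BoolMap.{u}} (e : α.dom ≃o β.dom) (e' : α.cod ≃o β.cod)
    (h : ∀ a, β.map (e a) = e' (α.map a)) : α ≅ β where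
  hom := ⟨(e : BoundedLatticeHom α.dom β.dom), (e' : CompleteLatticeHom α.cod β.cod), h⟩
  inv := ⟨(e.symm : BoundedLatticeHom β.dom α.dom), (e'.symm : CompleteLatticeHom β.cod α.cod),
    fun b => by
      apply e'.injective
      refine (h _).symm.trans ?_
      change β.map (e (e.symm b)) = e' (e'.symm _)
      simp⟩
  hom_inv_id := by
    apply BoolMap.Hom.ext
    · ext a
      exact e.symm_apply_apply a
    · ext a
      exact e'.symm_apply_apply a
  inv_hom_id := by
    apply BoolMap.Hom.ext
    · apply DFunLike.ext
      exact e.apply_symm_apply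
    · apply DFunLike.ext
      exact e'.apply_symm_apply

variable {α : BoolMap.{u}}

theorem map_le_map_iff_of_isZMap (h : IsZMap α.map) {a b : α.dom} :
    α.map a ≤ α.map b ↔ a ≤ b := by
  rw [← inf_eq_left, ← map_inf, h.injective.eq_iff, inf_eq_left]

/-- The trace of `stoneSet a` on the space of `α`. -/
def clopenTrace (α : BoolMap.{u}) (a : α.dom) : Clopens (pointSet α.map) :=
  ⟨Subtype.val ⁻¹' stoneSet a, (isClopen_stoneSet a).preimage continuous_subtype_val⟩

theorem point_mem_clopenTrace_iff (x : {x : α.cod // IsAtom x}) (a : α.dom) :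
    point α x ∈ clopenTrace α a ↔ x.1 ≤ α.map a :=
  atomHom_eq_true_iff _ _ _

theorem point_surjective : Function.Surjective (point α) := by
  rintro ⟨_, x, rfl⟩
  exact ⟨x, rfl⟩

/-- The set of all points `α_x` with `x ≤ b`. -/
def pointsBelow (α : BoolMap.{u}) (b : α.cod) : Set (pointSet α.map) :=
  {y | ∃ x, x.1 ≤ b ∧ point α x = y}

/-- Distinct atoms give distinct points, so the existential in `pointsBelow` has only `x` as its
witness. -/
theorem point_mem_pointsBelow_iff (h : IsZMap α.map) (x : {x : α.cod // IsAtom x}) (b : α.cod) :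
    point α x ∈ pointsBelow α b ↔ x.1 ≤ b := by
  refine ⟨?_, fun hx => ⟨x, hx, rfl⟩⟩
  rintro ⟨y, hy, hyx⟩
  rwa [← h.atomHom_injective (Subtype.ext_iff.1 hyx)]

theorem pointsBelow_subset_iff (h : IsZMap α.map) {b c : α.cod} :
    pointsBelow α b ⊆ pointsBelow α c ↔ b ≤ c := by
  refine Iff.trans ?_ (BooleanAlgebra.le_iff_atom_le_imp (x := b) (y := c)).symm
  constructor
  · intro hs x hx hb
    exact (point_mem_pointsBelow_iff h ⟨x, hx⟩ c).1
      (hs ((point_mem_pointsBelow_iff h ⟨x, hx⟩ b).2 hb))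
  · rintro hs _ ⟨x, hx, rfl⟩
    exact ⟨x, hs x.1 x.2 hx, rfl⟩

theorem pointsBelow_surjective (h : IsZMap α.map) : Function.Surjective (pointsBelow α) := by
  intro T
  -- An atom below a join lies below one of the joinands, so this join has no atoms below it beyond
  -- those of `T`.
  refine ⟨⨆ x : {x : {x : α.cod // IsAtom x} // point α x ∈ T}, x.1.1, ?_⟩
  ext y
  obtain ⟨x, rfl⟩ := point_surjective y
  rw [point_mem_pointsBelow_iff h]
  constructor
  · intro hx
    obtain ⟨z, hz⟩ := x.2.le_iSup.1 hx
    have hxz : x = z.1 := Subtype.ext ((z.1.2.le_iff_eq x.2.1).1 hz)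
    exact hxz ▸ z.2
  · exact fun hx => x.2.le_iSup.2 ⟨⟨x, hx⟩, le_rfl⟩

theorem coe_clopenTrace (h : IsZMap α.map) (a : α.dom) :
    (clopenTrace α a : Set (pointSet α.map)) = pointsBelow α (α.map a) := by
  ext y
  obtain ⟨x, rfl⟩ := point_surjective y
  exact (point_mem_clopenTrace_iff x a).trans (point_mem_pointsBelow_iff h x _).symm

theorem clopenTrace_le_iff (h : IsZMap α.map) {a b : α.dom} :
    clopenTrace α a ≤ clopenTrace α b ↔ a ≤ b := by
  rw [← SetLike.coe_subset_coe, coe_clopenTrace h, coe_clopenTrace h, pointsBelow_subset_iff h,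
    map_le_map_iff_of_isZMap h]

theorem clopenTrace_surjective (h : IsMZMap α.map) : Function.Surjective (clopenTrace α) := by
  intro U
  obtain ⟨a, ha⟩ := h.clopen_eq.subset U.isClopen
  exact ⟨a, SetLike.coe_injective ha⟩

/-- An mz-map `α : A → B` is isomorphic to the inclusion of `CO(X_α)` into `P(X_α)`. -/
noncomputable def mzIso (α : BoolMap.{u}) (h : IsMZMap α.map) :
    α ≅ clopenFunctor.obj (op (pointFunctor.obj (op α))) :=
  BoolMap.isoMk (β := clopenFunctor.obj (op (pointFunctor.obj (op α))))
    (RelIso.ofSurjective (OrderEmbedding.ofMapLEIff (clopenTrace α)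
      fun _ _ => clopenTrace_le_iff h.toIsZMap) (clopenTrace_surjective h))
    (RelIso.ofSurjective (OrderEmbedding.ofMapLEIff (pointsBelow α)
      fun _ _ => pointsBelow_subset_iff h.toIsZMap) (pointsBelow_surjective h.toIsZMap))
    (coe_clopenTrace h.toIsZMap)

theorem mzIso_naturality {α β : BoolMap.{u}} (f : α ⟶ β) (hα : IsMZMap α.map)
    (hβ : IsMZMap β.map) :
    f ≫ (mzIso β hβ).hom =
      (mzIso α hα).hom ≫ clopenFunctor.map (pointFunctor.map f.op).op := by
  apply BoolMap.Hom.ext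
  · rfl
  · apply DFunLike.ext
    intro b
    change pointsBelow β (f.σ b) = pointMap f ⁻¹' pointsBelow α b
    ext y
    obtain ⟨x, rfl⟩ := point_surjective y
    rw [point_mem_pointsBelow_iff hβ.toIsZMap, Set.mem_preimage, pointMap_apply,
      point_mem_pointsBelow_iff hα.toIsZMap]
    exact (atomMap_le_iff f.σ x.1 b).symm

end Counit

/-! ### Naturality for spaces and assembly of the equivalence -/

theorem pointMap_spacePoint {X Y : TopCat.{u}} (f : X ⟶ Y) (x : X) :
    pointMap (clopenFunctor.map f.op) (spacePoint x) = spacePoint (f x) := by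
  apply Subtype.ext
  ext U
  rw [Bool.eq_iff_iff]
  exact (spacePoint_mem_stoneSet_iff x (clopensComap f.hom U)).trans
    (spacePoint_mem_stoneSet_iff (f x) U).symm

/-- The homeomorphism `spaceHomeomorph` as an isomorphism in `TopCat`. -/
noncomputable def spaceIso (X : TopCat.{u}) (h : IsBooleanSpace X) :
    X ≅ pointFunctor.obj (op (clopenFunctor.obj (op X))) :=
  haveI := h.2.1
  TopCat.isoOfHomeo (spaceHomeomorph h.2.2)

theorem spaceIso_naturality {X Y : TopCat.{u}} (f : X ⟶ Y) (hX : IsBooleanSpace X)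
    (hY : IsBooleanSpace Y) :
    f ≫ (spaceIso Y hY).hom =
      (spaceIso X hX).hom ≫ pointFunctor.map (clopenFunctor.map f.op).op := by
  ext x
  exact (pointMap_spacePoint f x).symm

theorem isLMZ_clopenFunctor_obj {X : TopCat.{u}} (h : IsBooleanSpace X) :
    IsLMZ (clopenFunctor.obj (op X)) :=
  haveI := h.1
  haveI := h.2.1
  isLMZMap_clopensIncl h.2.2

/-- The functor from Boolean spaces to lmz-maps. -/
abbrev clopenLift : ZHLC.{u}ᵒᵖ ⥤ LMBool.{u} :=
  IsLMZ.lift (IsBooleanSpace.ι.op ⋙ clopenFunctor) fun X => isLMZ_clopenFunctor_obj X.unop.property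

/-- The functor from lmz-maps to Boolean spaces. -/
noncomputable abbrev pointLift : LMBool.{u}ᵒᵖ ⥤ ZHLC.{u} :=
  IsBooleanSpace.lift (IsLMZ.ι.op ⋙ pointFunctor) fun α => IsLMZ.isBooleanSpace α.unop.property

/-- The natural isomorphism of each Boolean space with the space of its lmz-map. -/
noncomputable def unitIso : 𝟭 ZHLC.{u}ᵒᵖ ≅ clopenLift ⋙ pointLift.rightOp :=
  NatIso.ofComponents
    (fun X => (IsBooleanSpace.isoMk (X := X.unop)
      (Y := pointLift.obj (op (clopenLift.obj X)))
      (spaceIso X.unop.obj X.unop.property)).symm.op)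
    (fun {X Y} (f : X ⟶ Y) => by
      have h := spaceIso_naturality f.unop.hom Y.unop.property X.unop.property
      apply Quiver.Hom.unop_inj
      apply ObjectProperty.hom_ext
      change (spaceIso _ Y.unop.property).inv ≫ f.unop.hom = _ ≫ (spaceIso _ X.unop.property).inv
      rw [Iso.inv_comp_eq, ← Category.assoc, Iso.eq_comp_inv]
      exact h)

/-- The natural isomorphism of each lmz-map with the lmz-map of its space. -/
noncomputable def counitIso : 𝟭 LMBool.{u} ≅ pointLift.rightOp ⋙ clopenLift :=
  NatIso.ofComponents
    (fun α => IsLMZ.isoMk (X := α) (Y := clopenLift.obj (op (pointLift.obj (op α))))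
      (mzIso α.obj α.property.toIsMZMap))
    (fun {α β} f => ObjectProperty.hom_ext _
      (mzIso_naturality f.hom α.property.toIsMZMap β.property.toIsMZMap))

end BooleanDuality

theorem theorem4p4 :
    ∃ (hF : ∀ X : ZHLC.{u}ᵒᵖ, IsLMZ (IsBooleanSpace.ι.op ⋙ clopenFunctor |>.obj X))
      (hG : ∀ α : LMBool.{u}ᵒᵖ, IsBooleanSpace (IsLMZ.ι.op ⋙ pointFunctor |>.obj α))
      (e : ZHLC.{u}ᵒᵖ ≌ LMBool.{u}),
      e.functor = IsLMZ.lift (IsBooleanSpace.ι.op ⋙ clopenFunctor) hF ∧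
      e.inverse = (IsBooleanSpace.lift (IsLMZ.ι.op ⋙ pointFunctor) hG).rightOp := 
    ⟨fun X => isLMZ_clopenFunctor_obj X.unop.property,
      fun α => IsLMZ.isBooleanSpace α.unop.property,
      -- `Equivalence.mk` may alter the unit to obtain the triangle identity but keeps both
      -- functors, so the two equalities are definitional.
      CategoryTheory.Equivalence.mk clopenLift pointLift.rightOp unitIso counitIso.symm, rfl, rfl⟩
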